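/- An influence graph $G=(V,E,(p_{uv})_{(u,v)\in E})$ is a finite directed graph with activation probabilities $p_{uv}\in[0,1]$. Its live-edge graph $L$ is the random subgraph that contains each edge $(u,v)\in E$ independently with probability $p_{uv}$. For $S\subseteq V$ let $R(S,L)$ be the set of nodes reachable in $L$ from a node of $S$, and let $\sigma(S)=\mathbb{E}_L[|R(S,L)|]$. Let $OPT_N(G,k)$ be the maximum of $\sigma(S)$ over the sets $S\subseteq V$ with $|S|=k$. An adaptive policy $\pi$ (with full-adoption feedback) selects seeds one at a time: given the partial realisation observed so far, i.e. the family of pairs $(v,R(\{v\},L))$ for the seeds $v$ selected so far, it deterministically returns the next seed or stops. We write $|\pi|=k$ if, on every live-edge graph, it stops after having selected exactly $k$ distinct seeds. Its value $\sigma(\pi)$ is the expected number of nodes reachable in $L$ from the selected seeds, and $OPT_A(G,k)$ is the maximum of $\sigma(\pi)$ over the policies with $|\pi|=k$. For a class $\mathcal{G}$ of influence graphs, the $k$-adaptivity gap is $$AG(\mathcal{G},k)=\sup_{G\in\mathcal{G},\ |V(G)|\ge k}\frac{OPT_A(G,k)}{OPT_N(G,k)}.$$ An influence graph is $0$-bounded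 if its edge set consists of the two orientations $(u,v),(v,u)$ of every edge of an undirected simple graph in which no node has degree higher than $2$ (that is, every connected component is a path, possibly a single node, or a cycle); the probabilities $p_{uv}$ and $p_{vu}$ may be distinct. **Theorem.** Let $\mathcal{G}$ be the class of $0$-bounded influence graphs. Then, for every integer $k\ge 2$, $$AG(\mathcal{G},k)\le\min\left\{k,\ \frac{3}{1-\left(\max\{0,1-3/k\}\right)^k}\right\}\le\frac{3e^3}{e^3-1}\approx 3.16,$$ where $\approx$ means that the two numbers differ by less than $0.005$. -/

import Mathlib

universe u

/-- An influence graph on the node set `V`: a set of directed edges `(u, v)`, each with an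
activation probability `prob u v ∈ [0, 1]`. (Values of `prob` off the edges are never used.) -/
structure InfluenceGraph (V : Type u) where
  Adj : V → V → Prop
  prob : V → V → ℝ
  prob_mem : ∀ u v, Adj u v → prob u v ∈ Set.Icc (0 : ℝ) 1

/-- A partial realisation: a partial function assigning to some nodes `v` (the selected seeds)
the set of nodes activated by `v`; `none` means that `v` is not in the domain. -/
abbrev PartialRealisation (V : Type u) : Type u := V → Option (Finset V)

/-- A (deterministic) adaptive policy: given the partial realisation observed so far, it returns
the next seed node, or `none`, which stands for STOP. -/
abbrev AdaptivePolicy (V : Type u) : Type u := PartialRealisation V → Option V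

namespace InfluenceGraph

variable {V : Type u} [Fintype V]

open Classical in
/-- The finite set of directed edges. -/
noncomputable def edges (G : InfluenceGraph V) : Finset (V × V) :=
  Finset.univ.filter fun e => G.Adj e.1 e.2

open Classical in
/-- The probability that the set of live edges is exactly `L ⊆ E`, when each edge `e` is live
with probability `p e`, independently of the other edges. -/
noncomputable def liveProb (G : InfluenceGraph V) (L : Finset (V × V)) : ℝ :=
  (∏ e ∈ L, G.prob e.1 e.2) * ∏ e ∈ G.edges \ L, (1 - G.prob e.1 e.2)

/-- The expectation of `X L` over the random live-edge graph `L`. -/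
noncomputable def expect (G : InfluenceGraph V) (X : Finset (V × V) → ℝ) : ℝ :=
  ∑ L ∈ G.edges.powerset, G.liveProb L * X L

end InfluenceGraph

section Diffusion

variable {V : Type u} [Fintype V]

open Classical in
/-- `R(S, L)`: the nodes reachable from `S` by a (possibly trivial) directed path in `L`. -/
noncomputable def reach (S : Finset V) (L : Finset (V × V)) : Finset V :=
  Finset.univ.filter fun v => ∃ u ∈ S, Relation.ReflTransGen (fun a b => (a, b) ∈ L) u v

open Classical in
/-- The domain of a partial realisation. -/
noncomputable def PartialRealisation.dom (ψ : PartialRealisation V) : Finset V :=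
  Finset.univ.filter fun v => ψ v ≠ none

open Classical in
/-- `R(ψ)`: the set of nodes activated by the seeds in the domain of `ψ`. -/
noncomputable def PartialRealisation.activated (ψ : PartialRealisation V) : Finset V :=
  Finset.univ.filter fun w => ∃ v A, ψ v = some A ∧ w ∈ A

namespace AdaptivePolicy

open Classical in
/-- One pass of the adaptive algorithm on the live-edge graph `L`: if the policy says STOP then
nothing changes, and if it selects `v` then `(v, R({v}, L))` is added to the partial realisation. -/
noncomputable def step (π : AdaptivePolicy V) (L : Finset (V × V)) (ψ : PartialRealisation V) :
    PartialRealisation V :=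
  match π ψ with
  | none => ψ
  | some v => Function.update ψ v (some (reach {v} L))

/-- The partial realisation returned by the adaptive algorithm on `L`, started at the empty partial
realisation. A pass that does not stop either enlarges the domain or changes nothing (and then
the algorithm never stops), so if the algorithm stops at all, it does so within `|V|` passes. -/
noncomputable def run (π : AdaptivePolicy V) (L : Finset (V × V)) : PartialRealisation V :=
  (π.step L)^[Fintype.card V] (fun _ => none)

end AdaptivePolicy

end Diffusion

namespace InfluenceGraph

variable {V : Type u} [Fintype V]

/-- `σ(S)`: the expected influence spread of a seed set. -/
noncomputable def spread (G : InfluenceGraph V) (S : Finset V) : ℝ :=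
  G.expect fun L => ((reach S L).card : ℝ)

/-- `|π| = k`: on every live-edge graph the algorithm stops, with exactly `k` seeds selected. -/
def PolicySize (G : InfluenceGraph V) (π : AdaptivePolicy V) (k : ℕ) : Prop :=
  ∀ L ⊆ G.edges, π (π.run L) = none ∧ (PartialRealisation.dom (π.run L)).card = k

/-- `σ(π)`: the expected influence spread of an adaptive policy. -/
noncomputable def policySpread (G : InfluenceGraph V) (π : AdaptivePolicy V) : ℝ :=
  G.expect fun L => ((PartialRealisation.activated (π.run L)).card : ℝ)

/-- The optimal value of the non-adaptive problem (a maximum over finitely many seed sets,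
nonempty when `k ≤ |V|`). -/
noncomputable def optN (G : InfluenceGraph V) (k : ℕ) : ℝ :=
  sSup (G.spread '' {S | S.card = k})

/-- The optimal value of the adaptive problem (a maximum over finitely many policies,
nonempty when `k ≤ |V|`). -/
noncomputable def optA (G : InfluenceGraph V) (k : ℕ) : ℝ :=
  sSup (G.policySpread '' {π | G.PolicySize π k})

open Classical in
/-- `α`-bounded influence graphs: the edges are the two orientations of the edges of an undirected
simple graph (the two probabilities may differ) in which the node degrees that are
higher than two sum to at most `α`. -/
def IsBounded (α : ℕ) (G : InfluenceGraph V) : Prop :=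
  ∃ H : SimpleGraph V, (∀ u v, G.Adj u v ↔ H.Adj u v) ∧
    (∑ v ∈ Finset.univ.filter (fun v => 2 < H.degree v), H.degree v) ≤ α

end InfluenceGraph

/-- The `k`-adaptivity gap of a class of finite influence graphs: the supremum, in the extended
reals, of `OPT_A(G, k) / OPT_N(G, k)` over the graphs `G` of the class for which `k` distinct seeds
can be chosen. -/
noncomputable def adaptivityGap
    (C : ∀ (V : Type u) [Fintype V], Set (InfluenceGraph V)) (k : ℕ) : EReal :=
  ⨆ (V : Type u) (_ : Fintype V) (G : InfluenceGraph V) (_ : G ∈ C V)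
    (_ : k ≤ Fintype.card V), ((G.optA k / G.optN k : ℝ) : EReal)

/-- The class of `α`-bounded influence graphs. -/
def boundedClass (α : ℕ) (V : Type u) [Fintype V] : Set (InfluenceGraph V) :=
  {G | G.IsBounded α}

/-!
Let `x v` be the probability that the policy selects `v`, and compare it with Poisson seeds: every
node `v` is drawn a Poisson number of times with mean `x v`, independently of the live edges. These
`k` seeds on average do no better than the best `k` seeds, since `(1 - t / k) ^ k ≤ exp (-t)`. So
it suffices to compare, for a single node `m`, the probabilities that the policy and the Poisson
seeds activate `m`.

The decision to select a node depends only on edges that leave active nodes. Following a path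
towards `m` edge by edge, as long as the current node is not active, the edge that leaves it is
independent of the past, and an induction shows that a policy seeding the live part of one path
hits it with at most twice the probability of the Poisson seeds. In a path or a cycle, `m` is
reached along at most two paths; they are independent, and together lose a factor `16 / 7`. This
fails only where the two live paths overlap, and then the whole component reaches `m`: if its total
seed probability is at least `16 / 7`, this costs only a factor `1 - exp (-16 / 7)`. If it is less,
the union bound over seeds and the concavity of `1 - exp (-t)` on `[0, 16 / 7]` give the same
constant.
-/

section RandomSubset

variable {α : Type*} [DecidableEq α]

theorem sum_powerset_union {M : Type*} [AddCommMonoid M] {s t : Finset α} (h : Disjoint s t)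
    (f : Finset α → M) :
    ∑ L ∈ (s ∪ t).powerset, f L = ∑ A ∈ s.powerset, ∑ B ∈ t.powerset, f (A ∪ B) := by
  induction s using Finset.induction_on generalizing f with
  | empty => simp
  | insert a s ha ih =>
    rw [Finset.disjoint_insert_left] at h
    rw [Finset.insert_union, Finset.sum_powerset_insert (by simp [ha, h.1]),
      Finset.sum_powerset_insert ha, ih h.2, ih h.2]
    simp only [Finset.insert_union]

/-- The expectation of `X L` over the random subset `L` of `s` that contains each `e ∈ s`
independently with probability `p e`. -/
def bernoulliExpect (p : α → ℝ) (s : Finset α) (X : Finset α → ℝ) : ℝ :=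
  ∑ L ∈ s.powerset, ((∏ e ∈ L, p e) * ∏ e ∈ s \ L, (1 - p e)) * X L

theorem bernoulliExpect_congr (p : α → ℝ) {s : Finset α} {X Y : Finset α → ℝ}
    (h : ∀ L ⊆ s, X L = Y L) : bernoulliExpect p s X = bernoulliExpect p s Y :=
  Finset.sum_congr rfl fun L hL => by rw [h L (Finset.mem_powerset.1 hL)]

theorem bernoulliExpect_const (p : α → ℝ) (s : Finset α) (c : ℝ) :
    bernoulliExpect p s (fun _ => c) = c := by
  rw [bernoulliExpect, ← Finset.sum_mul, ← Finset.prod_add]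
  simp

theorem bernoulliExpect_const_mul (p : α → ℝ) (s : Finset α) (c : ℝ) (X : Finset α → ℝ) :
    bernoulliExpect p s (fun L => c * X L) = c * bernoulliExpect p s X := by
  simp only [bernoulliExpect, Finset.mul_sum]
  exact Finset.sum_congr rfl fun _ _ => mul_left_comm _ _ _

theorem bernoulliExpect_union (p : α → ℝ) {s t : Finset α} (h : Disjoint s t)
    (X : Finset α → ℝ) :
    bernoulliExpect p (s ∪ t) X =
      bernoulliExpect p s fun A => bernoulliExpect p t fun B => X (A ∪ B) := by
  simp only [bernoulliExpect, sum_powerset_union h, Finset.mul_sum]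
  refine Finset.sum_congr rfl fun A hA => Finset.sum_congr rfl fun B hB => ?_
  rw [Finset.mem_powerset] at hA hB
  have hAB : Disjoint A B := h.mono hA hB
  have hsdiff : (s ∪ t) \ (A ∪ B) = s \ A ∪ t \ B := by
    ext e
    have := @hA e
    have := @hB e
    have := fun he : e ∈ s => Finset.disjoint_left.1 h he
    grind
  rw [hsdiff, Finset.prod_union hAB,
    Finset.prod_union (h.mono Finset.sdiff_subset Finset.sdiff_subset)]
  ring

theorem bernoulliExpect_mul_of_indep (p : α → ℝ) (s T : Finset α) {X Y : Finset α → ℝ}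
    (hX : ∀ L, X L = X (L ∩ T)) (hY : ∀ L, Y L = Y (L \ T)) :
    bernoulliExpect p s (fun L => X L * Y L) =
      bernoulliExpect p s X * bernoulliExpect p s Y := by
  have hdisj : Disjoint (s ∩ T) (s \ T) := (Finset.disjoint_sdiff_inter s T).symm
  have hX' : ∀ A, ∀ B ⊆ s \ T, X (A ∪ B) = X A := fun A B hB => by
    rw [hX, hX A]
    congr 1
    ext e
    have := @hB e
    grind
  have hY' : ∀ A ⊆ s ∩ T, ∀ B, Y (A ∪ B) = Y B := fun A hA B => by
    rw [hY, hY B]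
    congr 1
    ext e
    have := @hA e
    grind
  have factor : ∀ f : Finset α → ℝ, bernoulliExpect p s f =
      bernoulliExpect p (s ∩ T) fun A => bernoulliExpect p (s \ T) fun B => f (A ∪ B) := fun f => by
    rw [← bernoulliExpect_union p hdisj, Finset.union_comm, Finset.sdiff_union_inter]
  have hEX : bernoulliExpect p s X = bernoulliExpect p (s ∩ T) X := by
    rw [factor]
    refine bernoulliExpect_congr p fun A _ => ?_
    rw [bernoulliExpect_congr p (hX' A), bernoulliExpect_const]
  have hEY : bernoulliExpect p s Y = bernoulliExpect p (s \ T) Y := by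
    rw [factor, bernoulliExpect_congr p fun A hA => bernoulliExpect_congr p fun B _ => hY' A hA B,
      bernoulliExpect_const]
  rw [factor, hEX, hEY, mul_comm, ← bernoulliExpect_const_mul]
  refine bernoulliExpect_congr p fun A hA => ?_
  rw [mul_comm, ← bernoulliExpect_const_mul]
  exact bernoulliExpect_congr p fun B hB => by rw [hX' A B hB, hY' A hA B]

end RandomSubset

namespace InfluenceGraph

variable {V : Type*} [Fintype V] (G : InfluenceGraph V)

open scoped Classical in
theorem expect_eq_bernoulliExpect (X : Finset (V × V) → ℝ) :
    G.expect X = bernoulliExpect (fun e => G.prob e.1 e.2) G.edges X :=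
  rfl

theorem mem_edges {e : V × V} : e ∈ G.edges ↔ G.Adj e.1 e.2 := by
  simp [edges]

theorem liveProb_nonneg {L : Finset (V × V)} (hL : L ⊆ G.edges) : 0 ≤ G.liveProb L := by
  classical
  have hprob : ∀ e ∈ G.edges, G.prob e.1 e.2 ∈ Set.Icc (0 : ℝ) 1 := fun e he =>
    G.prob_mem _ _ (G.mem_edges.1 he)
  refine mul_nonneg (Finset.prod_nonneg fun e he => (hprob e (hL he)).1)
    (Finset.prod_nonneg fun e he => ?_)
  exact sub_nonneg.2 (hprob e (Finset.mem_sdiff.1 he).1).2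

theorem expect_mono {X Y : Finset (V × V) → ℝ} (h : ∀ L ⊆ G.edges, X L ≤ Y L) :
    G.expect X ≤ G.expect Y :=
  Finset.sum_le_sum fun L hL =>
    mul_le_mul_of_nonneg_left (h L (Finset.mem_powerset.1 hL))
      (G.liveProb_nonneg (Finset.mem_powerset.1 hL))

theorem expect_congr {X Y : Finset (V × V) → ℝ} (h : ∀ L ⊆ G.edges, X L = Y L) :
    G.expect X = G.expect Y :=
  Finset.sum_congr rfl fun L hL => by rw [h L (Finset.mem_powerset.1 hL)]

theorem expect_const (c : ℝ) : G.expect (fun _ => c) = c := by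
  classical rw [expect_eq_bernoulliExpect, bernoulliExpect_const]

theorem expect_const_mul (c : ℝ) (X : Finset (V × V) → ℝ) :
    G.expect (fun L => c * X L) = c * G.expect X := by
  classical simp only [expect_eq_bernoulliExpect, bernoulliExpect_const_mul]

theorem expect_add (X Y : Finset (V × V) → ℝ) :
    G.expect (fun L => X L + Y L) = G.expect X + G.expect Y := by
  simp only [expect, mul_add, Finset.sum_add_distrib]

theorem expect_sub (X Y : Finset (V × V) → ℝ) :
    G.expect (fun L => X L - Y L) = G.expect X - G.expect Y := by
  simp only [expect, mul_sub, Finset.sum_sub_distrib]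

theorem expect_sum {ι : Type*} (s : Finset ι) (X : ι → Finset (V × V) → ℝ) :
    G.expect (fun L => ∑ i ∈ s, X i L) = ∑ i ∈ s, G.expect (X i) := by
  simp only [expect, Finset.mul_sum]
  exact Finset.sum_comm

theorem expect_nonneg {X : Finset (V × V) → ℝ} (h : ∀ L ⊆ G.edges, 0 ≤ X L) :
    0 ≤ G.expect X :=
  (G.expect_const 0).ge.trans (G.expect_mono h)

open scoped Classical in
theorem expect_mul_of_indep (T : Finset (V × V)) {X Y : Finset (V × V) → ℝ}
    (hX : ∀ L, X L = X (L ∩ T)) (hY : ∀ L, Y L = Y (L \ T)) :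
    G.expect (fun L => X L * Y L) = G.expect X * G.expect Y :=
  bernoulliExpect_mul_of_indep _ _ T hX hY

open scoped Classical in
/-- The probability of an event depending on the random live-edge graph. -/
noncomputable def probability (P : Finset (V × V) → Prop) : ℝ :=
  G.expect fun L => if P L then 1 else 0

theorem probability_mono {P Q : Finset (V × V) → Prop} (h : ∀ L ⊆ G.edges, P L → Q L) :
    G.probability P ≤ G.probability Q :=
  G.expect_mono fun L hL => by
    by_cases hP : P L
    · rw [if_pos hP, if_pos (h L hL hP)]
    · rw [if_neg hP]
      split_ifs <;> norm_num

theorem probability_false : G.probability (fun _ => False) = 0 := by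
  simp only [probability, if_false, expect_const]

theorem probability_true : G.probability (fun _ => True) = 1 := by
  simp only [probability, if_true, expect_const]

theorem probability_nonneg (P : Finset (V × V) → Prop) : 0 ≤ G.probability P :=
  G.probability_false.ge.trans (G.probability_mono fun _ _ => False.elim)

theorem probability_le_one (P : Finset (V × V) → Prop) : G.probability P ≤ 1 :=
  (G.probability_mono fun _ _ _ => trivial).trans G.probability_true.le

theorem probability_or_le (P Q : Finset (V × V) → Prop) :
    G.probability (fun L => P L ∨ Q L) ≤ G.probability P + G.probability Q := by
  unfold probability
  rw [← expect_add]
  refine G.expect_mono fun L _ => ?_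
  by_cases hP : P L <;> by_cases hQ : Q L <;> simp [hP, hQ]

theorem probability_exists_le_sum {ι : Type*} (s : Finset ι) (P : ι → Finset (V × V) → Prop) :
    G.probability (fun L => ∃ i ∈ s, P i L) ≤ ∑ i ∈ s, G.probability (P i) := by
  classical
  induction s using Finset.induction_on with
  | empty => simp [probability_false]
  | insert i s hi ih =>
    simp only [Finset.exists_mem_insert]
    rw [Finset.sum_insert hi]
    exact (G.probability_or_le _ _).trans (add_le_add_right ih _)

open scoped Classical in
theorem probability_and_of_indep (T : Finset (V × V)) {P Q : Finset (V × V) → Prop}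
    (hP : ∀ L, P L ↔ P (L ∩ T)) (hQ : ∀ L, Q L ↔ Q (L \ T)) :
    G.probability (fun L => P L ∧ Q L) = G.probability P * G.probability Q := by
  unfold probability
  rw [← G.expect_mul_of_indep T (fun L => by simp only [hP L]) fun L => by simp only [hQ L]]
  refine G.expect_congr fun L _ => ?_
  by_cases hPL : P L <;> by_cases hQL : Q L <;> simp [hPL, hQL]

theorem probability_eq_sum_fiber {β : Type*} [Fintype β] (P : Finset (V × V) → Prop)
    (f : Finset (V × V) → β) :
    G.probability P = ∑ b, G.probability fun L => P L ∧ f L = b := by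
  classical
  unfold probability
  rw [← expect_sum]
  refine G.expect_congr fun L _ => ?_
  by_cases hP : P L <;> simp [hP]

theorem expect_card_eq_sum (S : Finset (V × V) → Finset V) :
    G.expect (fun L => ((S L).card : ℝ)) = ∑ v, G.probability fun L => v ∈ S L := by
  unfold probability
  rw [← expect_sum]
  exact G.expect_congr fun L _ => by simp

end InfluenceGraph

section Runs

variable {V : Type*}

/-- `w` is reachable from `v` along live edges. -/
def Reaches (L : Finset (V × V)) (v w : V) : Prop :=
  Relation.ReflTransGen (fun a b => (a, b) ∈ L) v w

theorem Reaches.mono {L L' : Finset (V × V)} (h : L ⊆ L') {v w : V} (hr : Reaches L v w) :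
    Reaches L' v w :=
  Relation.ReflTransGen.mono (fun _ _ hab => h hab) _ _ hr

theorem Reaches.of_agree {L L' : Finset (V × V)} {A : Set V} {v w : V}
    (hA : ∀ x, Reaches L v x → Reaches L x w → x ∈ A)
    (h : ∀ e : V × V, e.1 ∈ A → e ∈ L → e ∈ L') (hr : Reaches L v w) : Reaches L' v w := by
  induction hr using Relation.ReflTransGen.head_induction_on with
  | refl => exact Relation.ReflTransGen.refl
  | @head a b hab hbc ih =>
    refine Relation.ReflTransGen.head (h (a, b) (hA a .refl (.head hab hbc)) hab) (ih ?_)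
    exact fun x hx hxw => hA x (.head hab hx) hxw

variable [Fintype V]

theorem mem_reach {S : Finset V} {L : Finset (V × V)} {w : V} :
    w ∈ reach S L ↔ ∃ v ∈ S, Reaches L v w := by
  simp [reach, Reaches]

theorem mem_reach_singleton {L : Finset (V × V)} {v w : V} :
    w ∈ reach {v} L ↔ Reaches L v w := by
  simp [mem_reach]

namespace AdaptivePolicy

variable (π : AdaptivePolicy V) (L : Finset (V × V))

/-- The partial realisation after `i` passes of the adaptive algorithm. -/
noncomputable def state (i : ℕ) : PartialRealisation V :=
  (π.step L)^[i] (fun _ => none)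

theorem state_succ (i : ℕ) : π.state L (i + 1) = π.step L (π.state L i) :=
  Function.iterate_succ_apply' _ _ _

open Classical in
theorem state_succ_of_some {i : ℕ} {v : V} (h : π (π.state L i) = some v) :
    π.state L (i + 1) = Function.update (π.state L i) v (some (reach {v} L)) := by
  rw [state_succ, step]
  simp only [h]

theorem state_succ_of_none {i : ℕ} (h : π (π.state L i) = none) :
    π.state L (i + 1) = π.state L i := by
  rw [state_succ, step]
  simp only [h]

theorem state_value {i : ℕ} {v : V} {A : Finset V} (h : π.state L i v = some A) :
    A = reach {v} L := by
  classical
  induction i with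
  | zero => simp [state] at h
  | succ i ih =>
    cases hπ : π (π.state L i) with
    | none => exact ih (by rwa [state_succ_of_none π L hπ] at h)
    | some w =>
      rw [state_succ_of_some π L hπ] at h
      by_cases hw : v = w
      · subst hw
        simpa using h.symm
      · exact ih (by simpa [Function.update_of_ne hw] using h)

theorem state_ne_none_succ {i : ℕ} {v : V} (h : π.state L i v ≠ none) :
    π.state L (i + 1) v ≠ none := by
  classical
  cases hπ : π (π.state L i) with
  | none => rwa [state_succ_of_none π L hπ]
  | some w =>
    rw [state_succ_of_some π L hπ]
    by_cases hw : v = w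
    · subst hw
      simp
    · rwa [Function.update_of_ne hw]

theorem state_ne_none_mono {i j : ℕ} (hij : i ≤ j) {v : V} (h : π.state L i v ≠ none) :
    π.state L j v ≠ none := by
  induction j, hij using Nat.le_induction with
  | base => exact h
  | succ j _ ih => exact π.state_ne_none_succ L ih

theorem mem_activated_state {i : ℕ} {w : V} :
    w ∈ (π.state L i).activated ↔ ∃ v, π.state L i v ≠ none ∧ Reaches L v w := by
  simp only [PartialRealisation.activated, Finset.mem_filter, Finset.mem_univ, true_and]
  constructor
  · rintro ⟨v, A, hv, hw⟩
    refine ⟨v, by simp [hv], ?_⟩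
    rw [π.state_value L hv] at hw
    exact mem_reach_singleton.1 hw
  · rintro ⟨v, hv, hw⟩
    obtain ⟨A, hA⟩ := Option.ne_none_iff_exists'.1 hv
    refine ⟨v, A, hA, ?_⟩
    rw [π.state_value L hA]
    exact mem_reach_singleton.2 hw

theorem activated_closed {i : ℕ} {w z : V} (hw : w ∈ (π.state L i).activated)
    (h : Reaches L w z) : z ∈ (π.state L i).activated := by
  rw [mem_activated_state] at hw ⊢
  obtain ⟨v, hv, hvw⟩ := hw
  exact ⟨v, hv, hvw.trans h⟩

theorem activated_mono {i j : ℕ} (hij : i ≤ j) :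
    (π.state L i).activated ⊆ (π.state L j).activated := by
  intro w hw
  rw [mem_activated_state] at hw ⊢
  obtain ⟨v, hv, hvw⟩ := hw
  exact ⟨v, π.state_ne_none_mono L hij hv, hvw⟩

/-- In pass `i` the algorithm selects `v` as a new seed. -/
def Picks (i : ℕ) (v : V) : Prop :=
  π (π.state L i) = some v ∧ π.state L i v = none

theorem Picks.state_ne_none {i j : ℕ} {v : V} (h : π.Picks L i v) (hij : i < j) :
    π.state L j v ≠ none := by
  classical
  refine π.state_ne_none_mono L hij ?_
  rw [π.state_succ_of_some L h.1]
  simp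

theorem Picks.unique {i j : ℕ} {v : V} (hi : π.Picks L i v) (hj : π.Picks L j v) : i = j := by
  rcases lt_trichotomy i j with h | h | h
  · exact absurd hj.2 (hi.state_ne_none π L h)
  · exact h
  · exact absurd hi.2 (hj.state_ne_none π L h)

theorem exists_picks_of_mem_activated {n : ℕ} {m : V} (h : m ∈ (π.state L n).activated) :
    ∃ i < n, ∃ v, π.Picks L i v ∧ m ∉ (π.state L i).activated ∧ Reaches L v m := by
  classical
  induction n with
  | zero => simp [state, PartialRealisation.activated] at h
  | succ n ih =>
    by_cases hn : m ∈ (π.state L n).activated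
    · obtain ⟨i, hi, hh⟩ := ih hn
      exact ⟨i, by omega, hh⟩
    · cases hπ : π (π.state L n) with
      | none =>
        rw [state_succ_of_none π L hπ] at h
        exact absurd h hn
      | some v =>
        obtain ⟨w, hw, hwm⟩ := (π.mem_activated_state L).1 h
        have hwv : w = v := by
          by_contra hne
          rw [state_succ_of_some π L hπ, Function.update_of_ne hne] at hw
          exact hn ((π.mem_activated_state L).2 ⟨w, hw, hwm⟩)
        subst hwv
        refine ⟨n, by omega, w, ⟨hπ, ?_⟩, hn, hwm⟩
        by_contra hne
        exact hn ((π.mem_activated_state L).2 ⟨w, hne, hwm⟩)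

theorem mem_dom_run {v : V} :
    v ∈ (π.run L).dom ↔ π.state L (Fintype.card V) v ≠ none := by
  rw [PartialRealisation.dom, Finset.mem_filter]
  simp [run, state]

theorem state_congr {L L' : Finset (V × V)} {i : ℕ}
    (h : ∀ e : V × V, e.1 ∈ (π.state L i).activated → (e ∈ L ↔ e ∈ L')) :
    π.state L i = π.state L' i := by
  classical
  induction i with
  | zero => rfl
  | succ i ih =>
    have ih := ih fun e he => h e (π.activated_mono L i.le_succ he)
    cases hπ : π (π.state L i) with
    | none => rw [π.state_succ_of_none L hπ, π.state_succ_of_none L' (ih ▸ hπ), ih]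
    | some v =>
      have hv : ∀ w, Reaches L v w → w ∈ (π.state L (i + 1)).activated := fun w hw => by
        rw [mem_activated_state]
        refine ⟨v, ?_, hw⟩
        rw [state_succ_of_some π L hπ]
        simp
      have hreach : reach {v} L = reach {v} L' := by
        ext w
        rw [mem_reach_singleton, mem_reach_singleton]
        constructor
        · intro hw
          exact Reaches.of_agree (A := {x | x ∈ (π.state L (i + 1)).activated})
            (fun x hx _ => hv x hx) (fun e he hL => (h e he).1 hL) hw
        · intro hw
          induction hw with
          | refl => exact .refl
          | tail _ hbc ih => exact .tail ih ((h _ (hv _ ih)).2 hbc)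
      rw [π.state_succ_of_some L hπ, π.state_succ_of_some L' (ih ▸ hπ), ih, hreach]

theorem state_eq_iff_inter [DecidableEq V] (i : ℕ) (ψ : PartialRealisation V) :
    π.state L i = ψ ↔
      π.state (L ∩ Finset.univ.filter fun e : V × V => e.1 ∈ ψ.activated) i = ψ := by
  constructor <;> intro h
  · rw [← h]
    refine (π.state_congr fun e he => ?_).symm
    simp [he]
  · conv_rhs => rw [← h]
    refine (π.state_congr fun e he => ?_).symm
    rw [h] at he
    simp [he]

end AdaptivePolicy

end Runs

namespace InfluenceGraph

variable {V : Type*} [Fintype V] (G : InfluenceGraph V)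

section AdaptiveMarginals

variable (π : AdaptivePolicy V)

/-- The probability that the policy `π` selects `v` as a seed. -/
noncomputable def seedProb (v : V) : ℝ :=
  G.probability fun L => v ∈ (π.run L).dom

theorem seedProb_nonneg (v : V) : 0 ≤ G.seedProb π v :=
  G.probability_nonneg _

theorem sum_seedProb {k : ℕ} (h : G.PolicySize π k) : ∑ v, G.seedProb π v = k := by
  unfold seedProb
  rw [← expect_card_eq_sum, ← G.expect_const k]
  exact G.expect_congr fun L hL => by rw [(h L hL).2]

theorem sum_probability_picks_le (v : V) {n : ℕ} (hn : n ≤ Fintype.card V) :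
    ∑ i ∈ Finset.range n, G.probability (fun L => π.Picks L i v) ≤ G.seedProb π v := by
  classical
  unfold seedProb probability
  rw [← expect_sum]
  refine G.expect_mono fun L _ => ?_
  rw [Finset.sum_boole]
  split_ifs with hv
  · norm_cast
    refine Finset.card_le_one.2 fun i hi j hj => ?_
    exact (Finset.mem_filter.1 hi).2.unique π L (Finset.mem_filter.1 hj).2
  · rw [Finset.filter_false_of_mem fun i hi hpick => hv <| (π.mem_dom_run L).2 <|
      hpick.state_ne_none π L ((Finset.mem_range.1 hi).trans_le hn)]
    simp

/-- What the policy has observed is determined by the edges leaving activated nodes, whereas the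
live paths to a node `m` which is not yet activated avoid these edges. -/
theorem probability_state_eq_and_reaches_le (i : ℕ) {ψ : PartialRealisation V} {m : V}
    (hm : m ∉ ψ.activated) (v : V) :
    G.probability (fun L => π.state L i = ψ ∧ Reaches L v m) ≤
      G.probability (fun L => π.state L i = ψ) * G.probability (fun L => Reaches L v m) := by
  classical
  set T := Finset.univ.filter fun e : V × V => e.1 ∈ ψ.activated
  calc _ ≤ G.probability (fun L => π.state L i = ψ ∧ Reaches (L \ T) v m) := by
        refine G.probability_mono fun L _ => ?_
        rintro ⟨rfl, hreach⟩
        refine ⟨rfl, hreach.of_agree (A := {w | w ∉ (π.state L i).activated}) ?_ ?_⟩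
        · exact fun w _ hwm hw => hm (π.activated_closed L hw hwm)
        · exact fun e he heL => Finset.mem_sdiff.2 ⟨heL, by simpa [T] using he⟩
    _ = G.probability (fun L => π.state L i = ψ) *
          G.probability (fun L => Reaches (L \ T) v m) :=
        G.probability_and_of_indep T (fun L => π.state_eq_iff_inter L i ψ) fun L => by simp
    _ ≤ _ := mul_le_mul_of_nonneg_left
        (G.probability_mono fun L _ h => h.mono Finset.sdiff_subset) (G.probability_nonneg _)

theorem probability_picks_reaches_le (i : ℕ) (v m : V) :
    G.probability (fun L => π.Picks L i v ∧ m ∉ (π.state L i).activated ∧ Reaches L v m) ≤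
      G.probability (fun L => π.Picks L i v) * G.probability (fun L => Reaches L v m) := by
  classical
  rw [G.probability_eq_sum_fiber _ (fun L => π.state L i),
    G.probability_eq_sum_fiber (fun L => π.Picks L i v) (fun L => π.state L i), Finset.sum_mul]
  refine Finset.sum_le_sum fun ψ _ => ?_
  by_cases hψ : (π ψ = some v ∧ ψ v = none) ∧ m ∉ ψ.activated
  · calc _ ≤ G.probability (fun L => π.state L i = ψ ∧ Reaches L v m) :=
          G.probability_mono fun L _ h => ⟨h.2, h.1.2.2⟩
      _ ≤ _ := G.probability_state_eq_and_reaches_le π i hψ.2 v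
      _ ≤ _ := by
          refine mul_le_mul_of_nonneg_right (G.probability_mono fun L _ h => ?_)
            (G.probability_nonneg _)
          subst h
          exact ⟨hψ.1, rfl⟩
  · calc _ ≤ G.probability (fun _ => False) := by
          refine G.probability_mono fun L _ => ?_
          rintro ⟨⟨hpick, hm, -⟩, rfl⟩
          exact hψ ⟨hpick, hm⟩
      _ ≤ _ := by
          rw [probability_false]
          exact mul_nonneg (G.probability_nonneg _) (G.probability_nonneg _)

theorem probability_activated_le_sum (m : V) :
    G.probability (fun L => m ∈ (π.run L).activated) ≤
      ∑ v, G.seedProb π v * G.probability (fun L => Reaches L v m) := by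
  set n := Fintype.card V
  let first (i : ℕ) (v : V) (L : Finset (V × V)) : Prop :=
    π.Picks L i v ∧ m ∉ (π.state L i).activated ∧ Reaches L v m
  calc _ ≤ G.probability (fun L => ∃ v ∈ Finset.univ, ∃ i ∈ Finset.range n, first i v L) := by
        refine G.probability_mono fun L _ h => ?_
        obtain ⟨i, hi, v, hfirst⟩ := π.exists_picks_of_mem_activated L h
        exact ⟨v, Finset.mem_univ _, i, Finset.mem_range.2 hi, hfirst⟩
    _ ≤ ∑ v, ∑ i ∈ Finset.range n, G.probability (first i v) :=
        (G.probability_exists_le_sum _ _).trans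
          (Finset.sum_le_sum fun v _ => G.probability_exists_le_sum _ _)
    _ ≤ ∑ v, ∑ i ∈ Finset.range n,
          G.probability (fun L => π.Picks L i v) * G.probability (fun L => Reaches L v m) :=
        Finset.sum_le_sum fun v _ => Finset.sum_le_sum fun i _ =>
          G.probability_picks_reaches_le π i v m
    _ ≤ _ := Finset.sum_le_sum fun v _ => by
        rw [← Finset.sum_mul]
        exact mul_le_mul_of_nonneg_right (G.sum_probability_picks_le π v le_rfl)
          (G.probability_nonneg _)

end AdaptiveMarginals

section Optima

variable {k : ℕ}

theorem spread_mono {S T : Finset V} (h : S ⊆ T) : G.spread S ≤ G.spread T :=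
  G.expect_mono fun L _ => by
    refine Nat.cast_le.2 (Finset.card_le_card fun w hw => ?_)
    obtain ⟨v, hv, hvw⟩ := mem_reach.1 hw
    exact mem_reach.2 ⟨v, h hv, hvw⟩

theorem spread_nonneg (S : Finset V) : 0 ≤ G.spread S :=
  G.expect_nonneg fun _ _ => Nat.cast_nonneg _

theorem spread_le_optN {S : Finset V} (hS : S.card ≤ k) (hk : k ≤ Fintype.card V) :
    G.spread S ≤ G.optN k := by
  obtain ⟨T, hST, hT⟩ := Finset.exists_superset_card_eq hS hk
  exact (G.spread_mono hST).trans (le_csSup (Set.toFinite _).bddAbove ⟨T, hT, rfl⟩)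

theorem optN_nonneg (k : ℕ) : 0 ≤ G.optN k :=
  Real.sSup_nonneg (by rintro _ ⟨S, _, rfl⟩; exact G.spread_nonneg S)

theorem policySpread_le_mul_optN {π : AdaptivePolicy V} (hπ : G.PolicySize π k) (hk : 0 < k)
    (hkV : k ≤ Fintype.card V) : G.policySpread π ≤ k * G.optN k := by
  calc G.policySpread π = ∑ m, G.probability fun L => m ∈ (π.run L).activated :=
        G.expect_card_eq_sum _
    _ ≤ ∑ m, ∑ v, G.seedProb π v * G.probability (fun L => Reaches L v m) :=
        Finset.sum_le_sum fun m _ => G.probability_activated_le_sum π m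
    _ = ∑ v, G.seedProb π v * G.spread {v} := by
        rw [Finset.sum_comm]
        simp only [spread, expect_card_eq_sum, mem_reach_singleton, Finset.mul_sum]
    _ ≤ ∑ v, G.seedProb π v * G.optN k := Finset.sum_le_sum fun v _ =>
        mul_le_mul_of_nonneg_left (G.spread_le_optN ((Finset.card_singleton v).trans_le hk) hkV)
          (G.seedProb_nonneg π v)
    _ = k * G.optN k := by rw [← Finset.sum_mul, G.sum_seedProb π hπ]

end Optima

end InfluenceGraph

theorem adaptivityGap_le {C : ∀ (V : Type u) [Fintype V], Set (InfluenceGraph V)} {k : ℕ} {c : ℝ}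
    (hc : 0 ≤ c)
    (h : ∀ (V : Type u) [Fintype V], ∀ G ∈ C V, k ≤ Fintype.card V →
      ∀ π, G.PolicySize π k → G.policySpread π ≤ c * G.optN k) :
    adaptivityGap C k ≤ (c : EReal) := by
  refine iSup_le fun V => iSup_le fun _ => iSup_le fun G => iSup_le fun hG => iSup_le fun hV => ?_
  rw [EReal.coe_le_coe_iff]
  refine div_le_of_le_mul₀ (G.optN_nonneg k) hc
    (Real.sSup_le ?_ (mul_nonneg hc (G.optN_nonneg k)))
  rintro _ ⟨π, hπ, rfl⟩
  exact h V G hG hV π hπ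

section PoissonSeeds

variable {V : Type*}

/-- The probability that no node of `s` is drawn, when each occurrence of `v` is drawn a
Poisson number of times, with mean `x v`, independently of the others. -/
noncomputable def missProb (x : V → ℝ) (s : Multiset V) : ℝ :=
  Real.exp (-(s.map x).sum)

theorem missProb_zero (x : V → ℝ) : missProb x 0 = 1 := by
  simp [missProb]

theorem missProb_cons (x : V → ℝ) (v : V) (s : Multiset V) :
    missProb x (v ::ₘ s) = Real.exp (-x v) * missProb x s := by
  rw [missProb, Multiset.map_cons, Multiset.sum_cons, neg_add, Real.exp_add, missProb]

theorem missProb_add (x : V → ℝ) (s t : Multiset V) :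
    missProb x (s + t) = missProb x s * missProb x t := by
  rw [missProb, Multiset.map_add, Multiset.sum_add, neg_add, Real.exp_add, missProb, missProb]

theorem missProb_nonneg (x : V → ℝ) (s : Multiset V) : 0 ≤ missProb x s :=
  Real.exp_nonneg _

theorem missProb_antitone {x : V → ℝ} (hx : ∀ v, 0 ≤ x v) : Antitone (missProb x) := by
  intro s t hst
  obtain ⟨r, rfl⟩ := Multiset.le_iff_exists_add.1 hst
  rw [missProb_add]
  refine mul_le_of_le_one_right (missProb_nonneg x s) (Real.exp_le_one_iff.2 (neg_nonpos.2 ?_))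
  exact Multiset.sum_nonneg (Multiset.forall_mem_map_iff.2 fun v _ => hx v)

theorem missProb_le_one {x : V → ℝ} (hx : ∀ v, 0 ≤ x v) (s : Multiset V) : missProb x s ≤ 1 :=
  (missProb_antitone hx (Multiset.zero_le s)).trans (missProb_zero x).le

theorem missProb_val (x : V → ℝ) (s : Finset V) :
    missProb x s.val = Real.exp (-∑ v ∈ s, x v) :=
  rfl

variable [Fintype V]

open scoped Classical in
theorem sum_prod_mul_boole_exists_mem {y : V → ℝ} (hy : ∑ v, y v = 1) (k : ℕ) (S : Finset V) :
    ∑ f : Fin k → V, (∏ i, y (f i)) * (if ∃ i, f i ∈ S then 1 else 0) =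
      1 - (1 - ∑ v ∈ S, y v) ^ k := by
  have hcompl : ∑ v, (if v ∈ S then 0 else y v) = 1 - ∑ v ∈ S, y v := by
    rw [eq_sub_iff_add_eq, ← Fintype.sum_ite_mem S y, ← Finset.sum_add_distrib, ← hy]
    exact Finset.sum_congr rfl fun v _ => by split_ifs <;> simp
  have htotal : ∑ f : Fin k → V, ∏ i, y (f i) = 1 := by
    rw [← Fintype.sum_pow, hy, one_pow]
  rw [← hcompl, Fintype.sum_pow, eq_sub_iff_add_eq, ← Finset.sum_add_distrib]
  refine (Finset.sum_congr rfl fun f _ => ?_).trans htotal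
  split_ifs with hf
  · obtain ⟨i, hi⟩ := hf
    have hzero : ∏ j, (if f j ∈ S then 0 else y (f j)) = 0 :=
      Finset.prod_eq_zero (Finset.mem_univ i) (if_pos hi)
    rw [hzero, mul_one, add_zero]
  · push Not at hf
    simp [hf]

open scoped Classical in
/-- The nodes from which `m` can be reached along live edges. -/
noncomputable def coreach (L : Finset (V × V)) (m : V) : Finset V :=
  Finset.univ.filter fun v => Reaches L v m

theorem mem_coreach {L : Finset (V × V)} {v m : V} : v ∈ coreach L m ↔ Reaches L v m := by
  simp [coreach]

namespace InfluenceGraph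

variable (G : InfluenceGraph V)

theorem expect_sum_coreach (x : V → ℝ) (m : V) :
    G.expect (fun L => ∑ v ∈ coreach L m, x v) =
      ∑ v, x v * G.probability fun L => Reaches L v m := by
  unfold probability
  simp_rw [← expect_const_mul]
  rw [← expect_sum]
  exact G.expect_congr fun L _ => by simp [coreach, Finset.sum_filter]

open scoped Classical in
theorem sum_prod_mul_spread_image_le_optN {y : V → ℝ} (hy : ∀ v, 0 ≤ y v) (hsum : ∑ v, y v = 1)
    {k : ℕ} (hk : k ≤ Fintype.card V) :
    ∑ f : Fin k → V, (∏ i, y (f i)) * G.spread (Finset.univ.image f) ≤ G.optN k := by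
  calc _ ≤ ∑ f : Fin k → V, (∏ i, y (f i)) * G.optN k := by
        refine Finset.sum_le_sum fun f _ => mul_le_mul_of_nonneg_left ?_
          (Finset.prod_nonneg fun i _ => hy _)
        exact G.spread_le_optN (Finset.card_image_le.trans (by simp)) hk
    _ = G.optN k := by rw [← Finset.sum_mul, ← Fintype.sum_pow, hsum, one_pow, one_mul]

/-- Poisson seeds of total mean `k` do not beat the best `k` seeds: `k` independent draws of a
node from the distribution `x / k` do at least as well. -/
theorem sum_expect_one_sub_missProb_le_optN {x : V → ℝ} (hx : ∀ v, 0 ≤ x v) {k : ℕ}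
    (hk : 0 < k) (hkV : k ≤ Fintype.card V) (hsum : ∑ v, x v = k) :
    ∑ m, G.expect (fun L => 1 - missProb x (coreach L m).val) ≤ G.optN k := by
  classical
  have hk' : (0 : ℝ) < k := Nat.cast_pos.2 hk
  have hy : ∑ v, x v / k = 1 := by rw [← Finset.sum_div, hsum, div_self hk'.ne']
  have hmiss : ∀ S : Finset V, (1 - ∑ v ∈ S, x v / k) ^ k ≤ missProb x S.val := fun S => by
    rw [missProb_val, ← Finset.sum_div]
    refine Real.one_sub_div_pow_le_exp_neg ?_
    rw [← hsum]
    exact Finset.sum_le_univ_sum_of_nonneg hx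
  calc _ ≤ ∑ m, G.expect fun L => ∑ f : Fin k → V,
          (∏ i, x (f i) / k) * if ∃ i, f i ∈ coreach L m then 1 else 0 := by
        refine Finset.sum_le_sum fun m _ => G.expect_mono fun L _ => ?_
        rw [sum_prod_mul_boole_exists_mem hy]
        exact sub_le_sub_left (hmiss _) 1
    _ = ∑ f : Fin k → V, (∏ i, x (f i) / k) * G.spread (Finset.univ.image f) := by
        simp only [expect_sum, expect_const_mul, spread, expect_card_eq_sum, Finset.mul_sum]
        rw [Finset.sum_comm]
        refine Finset.sum_congr rfl fun f _ => Finset.sum_congr rfl fun m _ => ?_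
        simp only [probability, mem_reach, mem_coreach, Finset.mem_image, Finset.mem_univ,
          true_and, exists_exists_eq_and]
    _ ≤ G.optN k :=
        G.sum_prod_mul_spread_image_le_optN (fun v => div_nonneg (hx v) hk'.le) hy hkV

end InfluenceGraph

end PoissonSeeds

section Arms

variable {V : Type*}

/-- The edges `(l[0], u), (l[1], l[0]), (l[2], l[1]), …` of a path `u, l[0], l[1], …`, directed
towards its end `u`. -/
def armEdges : V → List V → List (V × V)
  | _, [] => []
  | u, w :: l => (w, u) :: armEdges w l

open scoped Classical in
/-- The longest initial segment of `l` whose nodes reach `u` along live edges of the path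
`u, l[0], l[1], …`. -/
noncomputable def liveArm (L : Finset (V × V)) : V → List V → List V
  | _, [] => []
  | u, w :: l => if (w, u) ∈ L then w :: liveArm L w l else []

theorem mem_armEdges {u : V} {l : List V} {e : V × V} :
    e ∈ armEdges u l ↔
      ∃ (i : ℕ) (h : i + 1 < (u :: l).length), e = ((u :: l)[i + 1], (u :: l)[i]) := by
  induction l generalizing u with
  | nil => simp [armEdges]
  | cons w l ih =>
    rw [armEdges, List.mem_cons, ih]
    constructor
    · rintro (rfl | ⟨i, h, rfl⟩)
      · exact ⟨0, by simp, rfl⟩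
      · exact ⟨i + 1, by simpa using h, rfl⟩
    · rintro ⟨_ | i, h, rfl⟩
      · exact .inl rfl
      · exact .inr ⟨i, by simpa using h, rfl⟩

theorem snd_mem_of_mem_armEdges {u : V} {l : List V} {e : V × V} (he : e ∈ armEdges u l) :
    e.2 ∈ u :: l := by
  obtain ⟨i, hi, rfl⟩ := mem_armEdges.1 he
  exact List.getElem_mem _

theorem liveArm_congr {L L' : Finset (V × V)} {u : V} {l : List V}
    (h : ∀ e ∈ armEdges u l, (e ∈ L ↔ e ∈ L')) : liveArm L u l = liveArm L' u l := by
  classical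
  induction l generalizing u with
  | nil => rfl
  | cons w l ih =>
    simp only [armEdges, List.mem_cons, forall_eq_or_imp] at h
    rw [liveArm, liveArm, ih h.2]
    exact if_congr h.1 rfl rfl

theorem liveArm_isPrefix (L : Finset (V × V)) (u : V) (l : List V) : liveArm L u l <+: l := by
  induction l generalizing u with
  | nil => simp [liveArm]
  | cons w l ih =>
    rw [liveArm]
    split_ifs
    · simpa using ih w
    · exact List.nil_prefix

theorem reaches_of_mem_liveArm {L : Finset (V × V)} {u v : V} {l : List V}
    (hv : v ∈ liveArm L u l) : Reaches L v u := by
  induction l generalizing u with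
  | nil => simp [liveArm] at hv
  | cons w l ih =>
    rw [liveArm] at hv
    split_ifs at hv with hwu
    · rcases List.mem_cons.1 hv with rfl | hv
      · exact .single hwu
      · exact .tail (ih hv) hwu
    · simp at hv

end Arms

section ArmBound

variable {V : Type*} [Fintype V]

namespace AdaptivePolicy

variable (π : AdaptivePolicy V) {L L' : Finset (V × V)} {u w : V} {l : List V}

/-- Some pass selects a new seed on the list `l` at a time when the node `u` is not yet active. -/
def PicksFrom (L : Finset (V × V)) (u : V) (l : List V) : Prop :=
  ∃ i < Fintype.card V, ∃ v ∈ l, π.Picks L i v ∧ u ∉ (π.state L i).activated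

theorem not_picksFrom_nil : ¬ π.PicksFrom L u [] := by
  simp [PicksFrom]

theorem PicksFrom.of_agree (h : ∀ e : V × V, e.1 ≠ u → (e ∈ L ↔ e ∈ L'))
    (hp : π.PicksFrom L u l) : π.PicksFrom L' u l := by
  obtain ⟨i, hi, v, hv, hpick, hu⟩ := hp
  have hstate : π.state L i = π.state L' i :=
    π.state_congr fun e he => h e fun heu => hu (heu ▸ he)
  rw [Picks, hstate] at hpick
  exact ⟨i, hi, v, hv, hpick, hstate ▸ hu⟩

theorem picksFrom_sdiff_singleton_iff [DecidableEq V] (v : V) :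
    π.PicksFrom (L \ {(u, v)}) u l ↔ π.PicksFrom L u l := by
  have hagree : ∀ e : V × V, e.1 ≠ u → (e ∈ L \ {(u, v)} ↔ e ∈ L) := fun e he => by
    have : e ≠ (u, v) := fun h => he (by rw [h])
    simp [this]
  exact ⟨.of_agree π hagree, .of_agree π fun e he => (hagree e he).symm⟩

theorem PicksFrom.of_cons (hp : π.PicksFrom L u (u :: l)) :
    u ∈ (π.run L).dom ∨ π.PicksFrom L u l := by
  obtain ⟨i, hi, v, hv, hpick, hu⟩ := hp
  rcases List.mem_cons.1 hv with rfl | hv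
  · exact .inl ((π.mem_dom_run L).2 (hpick.state_ne_none π L hi))
  · exact .inr ⟨i, hi, v, hv, hpick, hu⟩

theorem PicksFrom.of_mem (h : (w, u) ∈ L) (hp : π.PicksFrom L u l) : π.PicksFrom L w l := by
  obtain ⟨i, hi, v, hv, hpick, hu⟩ := hp
  exact ⟨i, hi, v, hv, hpick, fun hw => hu (π.activated_closed L hw (.single h))⟩

end AdaptivePolicy

theorem le_two_sub_two_mul_exp_neg_mul {x t a R : ℝ} (hx : 0 ≤ x) (ha : a ≤ 1)
    (hat : a ≤ x + t) (hR : t ≤ 2 - 2 * R) : a ≤ 2 - 2 * (Real.exp (-x) * R) := by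
  have hexp : Real.exp (-x) * (1 + x) ≤ 1 := by
    rw [Real.exp_neg, inv_mul_le_one₀ (Real.exp_pos x), add_comm]
    exact Real.add_one_le_exp x
  have hlin : 2 - t ≤ (1 + x) * (2 - a) := by
    rcases le_total (x + t) 1 with h | h
    · nlinarith [mul_nonneg hx (sub_nonneg.2 h)]
    · nlinarith [h, mul_nonneg hx (sub_nonneg.2 ha)]
  have hmul : Real.exp (-x) * (2 * R) ≤ 2 - a := by
    calc Real.exp (-x) * (2 * R) ≤ Real.exp (-x) * ((1 + x) * (2 - a)) :=
          mul_le_mul_of_nonneg_left (by linarith) (Real.exp_nonneg _)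
      _ = Real.exp (-x) * (1 + x) * (2 - a) := by ring
      _ ≤ 1 * (2 - a) := mul_le_mul_of_nonneg_right hexp (by linarith)
      _ = 2 - a := one_mul _
  linarith

namespace InfluenceGraph

variable (G : InfluenceGraph V) (π : AdaptivePolicy V)

open scoped Classical in
theorem expect_ite_mem_of_indep (e : V × V) {X : Finset (V × V) → ℝ}
    (hX : ∀ L, X L = X (L \ {e})) :
    G.expect (fun L => if e ∈ L then X L else 1) =
      1 - G.probability (fun L => e ∈ L) + G.probability (fun L => e ∈ L) * G.expect X := by
  rw [probability, ← G.expect_mul_of_indep {e} (fun L => by simp) hX, ← G.expect_const 1,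
    ← expect_sub, ← expect_add]
  exact G.expect_congr fun L _ => by split_ifs <;> simp [G.expect_const]

theorem probability_picksFrom_cons_le (u : V) (l : Finset (V × V) → List V)
    (h : G.probability (fun L => π.PicksFrom L u (l L)) ≤
      2 - 2 * G.expect fun L => missProb (G.seedProb π) (l L)) :
    G.probability (fun L => π.PicksFrom L u (u :: l L)) ≤
      2 - 2 * G.expect fun L => missProb (G.seedProb π) (u :: l L : List V) := by
  simp only [← Multiset.cons_coe, missProb_cons, expect_const_mul]
  refine le_two_sub_two_mul_exp_neg_mul (G.seedProb_nonneg π u) (G.probability_le_one _) ?_ h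
  exact (G.probability_mono fun L _ hL => hL.of_cons π).trans (G.probability_or_le _ _)

/-- Along a path, Poisson seeds with the selection rates of an adaptive policy are at least half as
good as the policy. -/
theorem probability_picksFrom_liveArm_le {u : V} {l : List V} (hl : (u :: l).Nodup) :
    G.probability (fun L => π.PicksFrom L u (liveArm L u l)) ≤
      2 - 2 * G.expect fun L => missProb (G.seedProb π) (liveArm L u l) := by
  classical
  induction l generalizing u with
  | nil =>
    simp [liveArm, π.not_picksFrom_nil, missProb_zero, probability_false, expect_const]
  | cons w l ih =>
    obtain ⟨hu, hwl⟩ := List.nodup_cons.1 hl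
    have hcongr : ∀ L, liveArm L w l = liveArm (L \ {(w, u)}) w l := fun L =>
      liveArm_congr fun e he => by
        have : e ≠ (w, u) := by
          rintro rfl
          exact hu (snd_mem_of_mem_armEdges he)
        simp [this]
    set g := G.probability fun L => (w, u) ∈ L
    have hpick : G.probability (fun L => π.PicksFrom L u (liveArm L u (w :: l))) ≤
        g * G.probability fun L => π.PicksFrom L w (w :: liveArm L w l) := by
      rw [← G.probability_and_of_indep {(w, u)} (fun L => by simp) fun L => by
        rw [← hcongr, π.picksFrom_sdiff_singleton_iff]]
      refine G.probability_mono fun L _ hL => ?_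
      by_cases hwu : (w, u) ∈ L
      · rw [liveArm, if_pos hwu] at hL
        exact ⟨hwu, hL.of_mem π hwu⟩
      · rw [liveArm, if_neg hwu] at hL
        exact absurd hL (π.not_picksFrom_nil)
    have hmiss : G.expect (fun L => missProb (G.seedProb π) (liveArm L u (w :: l))) =
        1 - g + g * G.expect fun L => missProb (G.seedProb π) (w :: liveArm L w l : List V) := by
      rw [← G.expect_ite_mem_of_indep (w, u) fun L => by rw [← hcongr]]
      refine G.expect_congr fun L _ => ?_
      rw [liveArm]
      split_ifs
      · rfl
      · exact missProb_zero _
    have htail := mul_le_mul_of_nonneg_left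
      (G.probability_picksFrom_cons_le π w _ (ih hwl)) (G.probability_nonneg fun L => (w, u) ∈ L)
    linarith

end InfluenceGraph

end ArmBound

section Forks

variable {V : Type*} {H : SimpleGraph V} {m : V} {p q : List V}

/-- Every node of the graph has at most two neighbours, that is, every component is a path or a
cycle. -/
def AtMostTwoNeighbors (H : SimpleGraph V) : Prop :=
  ∀ ⦃v a b c⦄, H.Adj v a → H.Adj v b → H.Adj v c → a = b ∨ a = c ∨ b = c

theorem AtMostTwoNeighbors.mem_of_reachable (hH : AtMostTwoNeighbors H) {U : Set V} (hm : m ∈ U)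
    (hU : ∀ v ∈ U, ∃ a ∈ U, ∃ b ∈ U, a ≠ b ∧ H.Adj v a ∧ H.Adj v b) {v : V}
    (hv : H.Reachable m v) : v ∈ U := by
  rw [SimpleGraph.reachable_iff_reflTransGen] at hv
  induction hv with
  | refl => exact hm
  | @tail v w _ hvw ih =>
    obtain ⟨a, ha, b, hb, hab, hva, hvb⟩ := hU v ih
    rcases hH hva hvb hvw with h | rfl | rfl
    · exact absurd h hab
    · exact ha
    · exact hb

/-- Two paths `m, p[0], p[1], …` and `m, q[0], q[1], …` that start at `m` with different edges. -/
structure Fork (H : SimpleGraph V) (m : V) (p q : List V) : Prop where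
  chain_left : (m :: p).IsChain H.Adj
  chain_right : (m :: q).IsChain H.Adj
  nodup_left : (m :: p).Nodup
  nodup_right : (m :: q).Nodup
  ne : ∀ (h : 0 < p.length) (h' : 0 < q.length), p[0] ≠ q[0]

namespace Fork

theorem symm (F : Fork H m p q) : Fork H m q p :=
  ⟨F.chain_right, F.chain_left, F.nodup_right, F.nodup_left, fun h h' => (F.ne h' h).symm⟩

theorem of_isPrefix (F : Fork H m p q) {s t : List V} (hs : s <+: p) (ht : t <+: q) :
    Fork H m s t := by
  have hs' : m :: s <+: m :: p := (List.prefix_cons_inj m).2 hs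
  have ht' : m :: t <+: m :: q := (List.prefix_cons_inj m).2 ht
  refine ⟨F.chain_left.prefix hs', F.chain_right.prefix ht', F.nodup_left.sublist hs'.sublist,
    F.nodup_right.sublist ht'.sublist, fun h h' => ?_⟩
  rw [hs.getElem h, ht.getElem h']
  exact F.ne _ _

theorem getElem_succ_ne (hH : AtMostTwoNeighbors H) (F : Fork H m p q) {i j : ℕ}
    (hi : i < p.length) (hj : j < q.length)
    (h : (m :: p)[i]'(Nat.lt_succ_of_lt hi) = (m :: q)[j]'(Nat.lt_succ_of_lt hj)) :
    p[i] ≠ q[j] := by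
  have hp := List.isChain_iff_getElem.1 F.chain_left
  have hq := List.isChain_iff_getElem.1 F.chain_right
  induction i generalizing j with
  | zero =>
    obtain rfl : 0 = j := (F.nodup_right.getElem_inj_iff (hi := Nat.succ_pos _)).1 h
    exact F.ne _ _
  | succ i ih =>
    cases j with
    | zero => exact absurd (F.nodup_left.getElem_inj_iff (hj := Nat.succ_pos _) |>.1 h) (by simp)
    | succ j =>
      intro hsucc
      have hqi : H.Adj ((m :: p)[i + 1]'(Nat.lt_succ_of_lt hi))
          ((m :: q)[j]'(by simp; omega)) := h ▸ (hq j (by simp; omega)).symm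
      rcases hH (hp i (by simp; omega)).symm hqi (hp (i + 1) (by simpa using hi))
        with hpq | hpp | hqp
      · exact ih (by omega) (by omega) hpq h
      · have := F.nodup_left.getElem_inj_iff.1 hpp
        omega
      · have hqq : (m :: q)[j]'(by simp; omega) = (m :: q)[j + 2]'(by simp; omega) :=
          hqp.trans hsucc
        have := F.nodup_right.getElem_inj_iff.1 hqq
        omega

theorem disjoint_armEdges (hH : AtMostTwoNeighbors H) (F : Fork H m p q) :
    (armEdges m p).Disjoint (armEdges m q) := by
  intro e hep heq
  obtain ⟨i, hi, rfl⟩ := mem_armEdges.1 hep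
  obtain ⟨j, hj, h⟩ := mem_armEdges.1 heq
  rw [Prod.mk.injEq] at h
  exact F.getElem_succ_ne hH (by simpa using hi) (by simpa using hj) h.2 h.1

theorem exists_two_neighbors (hH : AtMostTwoNeighbors H) {x : V}
    (F : Fork H m (p ++ [x]) (q ++ [x])) {v : V} (hv : v ∈ m :: (p ++ [x])) :
    ∃ a ∈ {w | w ∈ m :: (p ++ [x]) ∨ w ∈ m :: (q ++ [x])},
      ∃ b ∈ {w | w ∈ m :: (p ++ [x]) ∨ w ∈ m :: (q ++ [x])},
        a ≠ b ∧ H.Adj v a ∧ H.Adj v b := by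
  have hp := List.isChain_iff_getElem.1 F.chain_left
  have hq := List.isChain_iff_getElem.1 F.chain_right
  obtain ⟨i, hi, rfl⟩ := List.mem_iff_getElem.1 hv
  cases i with
  | zero =>
    exact ⟨_, .inl (List.getElem_mem _), _, .inr (List.getElem_mem _),
      F.ne (by simp) (by simp), hp 0 (by simp), hq 0 (by simp)⟩
  | succ i =>
    rcases Nat.lt_or_ge i p.length with hlt | hge
    · refine ⟨_, .inl (List.getElem_mem _), _, .inl (List.getElem_mem _), fun h => ?_,
        (hp i hi).symm, hp (i + 1) (by simpa using hlt)⟩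
      have := F.nodup_left.getElem_inj_iff.1 h
      omega
    · obtain rfl : i = p.length := by simp at hi; omega
      have hx : (m :: (p ++ [x]))[p.length + 1] = (m :: (q ++ [x]))[q.length + 1]'(by simp) := by
        simp
      exact ⟨_, .inl (List.getElem_mem _), _, .inr (List.getElem_mem _),
        fun h => F.getElem_succ_ne hH (by simp) (by simp) h hx, (hp p.length hi).symm,
        hx ▸ (hq q.length (by simp)).symm⟩

theorem mem_or_mem_of_reachable (hH : AtMostTwoNeighbors H) (F : Fork H m p q)
    (hpq : ¬ p.Disjoint q) {v : V} (hv : H.Reachable m v) : v ∈ m :: p ∨ v ∈ m :: q := by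
  obtain ⟨x, hxp, hxq⟩ : ∃ x, x ∈ p ∧ x ∈ q := by simpa [List.Disjoint] using hpq
  obtain ⟨p₁, p₂, rfl⟩ := List.append_of_mem hxp
  obtain ⟨q₁, q₂, rfl⟩ := List.append_of_mem hxq
  have hp : p₁ ++ [x] <+: p₁ ++ x :: p₂ := ⟨p₂, by simp⟩
  have hq : q₁ ++ [x] <+: q₁ ++ x :: q₂ := ⟨q₂, by simp⟩
  have F' := F.of_isPrefix hp hq
  have hmem : v ∈ {w | w ∈ m :: (p₁ ++ [x]) ∨ w ∈ m :: (q₁ ++ [x])} := by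
    refine hH.mem_of_reachable (.inl List.mem_cons_self) ?_ hv
    rintro w (hw | hw)
    · exact F'.exists_two_neighbors hH hw
    · simpa only [or_comm] using F'.symm.exists_two_neighbors hH hw
  exact hmem.imp (fun h => ((List.prefix_cons_inj m).2 hp).subset h)
    fun h => ((List.prefix_cons_inj m).2 hq).subset h

end Fork

theorem reflTransGen_avoiding_cases {r : V → V → Prop} {B : Set V} {u v : V}
    (h : Relation.ReflTransGen (fun a b => r a b ∧ a ∉ B) v u) :
    v = u ∨ ∃ w ∉ insert u B, r w u ∧
      Relation.ReflTransGen (fun a b => r a b ∧ a ∉ insert u B) v w := by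
  induction h using Relation.ReflTransGen.head_induction_on with
  | refl => exact .inl rfl
  | @head a c hac hcu ih =>
    rcases eq_or_ne a u with hau | hau
    · exact .inl hau
    · have ha : a ∉ insert u B := by simp [hau, hac.2]
      rcases ih with rfl | ⟨w, hw, hwu, hcw⟩
      · exact .inr ⟨a, ha, hac.1, .refl⟩
      · exact .inr ⟨w, hw, hwu, .head ⟨hac.1, ha⟩ hcw⟩

/-- The nodes of `B` are those already visited when the arm has been followed up to `u`, and `N`
contains the possible next nodes. -/
theorem exists_arm [Finite V] (hH : AtMostTwoNeighbors H) (B : Set V) {u : V} (hu : u ∈ B)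
    {N : Set V} (hN : N.Subsingleton) (hNB : ∀ w ∈ N, H.Adj u w ∧ w ∉ B) :
    ∃ l : List V, (u :: l).IsChain H.Adj ∧ l.Nodup ∧ (∀ w ∈ l, w ∉ B) ∧
      (∀ h : 0 < l.length, l[0] ∈ N) ∧
      ∀ L : Finset (V × V), (∀ e ∈ L, H.Adj e.1 e.2) → ∀ w ∈ N, (w, u) ∈ L → ∀ v,
        Relation.ReflTransGen (fun a b => (a, b) ∈ L ∧ a ∉ B) v w → v ∈ liveArm L u l := by
  induction B using WellFoundedGT.induction generalizing u N with
  | _ B ih =>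
  rcases N.eq_empty_or_nonempty with rfl | ⟨w, hw⟩
  · exact ⟨[], by simp⟩
  obtain ⟨huw, hwB⟩ := hNB w hw
  have hnext : {z | H.Adj w z ∧ z ∉ insert w B}.Subsingleton := by
    rintro a ⟨hwa, ha⟩ b ⟨hwb, hb⟩
    rcases hH huw.symm hwa hwb with rfl | rfl | hab
    · exact absurd (.inr hu) ha
    · exact absurd (.inr hu) hb
    · exact hab
  obtain ⟨l, hchain, hnodup, hlB, -, hlive⟩ :=
    ih (insert w B) (Set.ssubset_insert hwB) (Set.mem_insert w B) hnext fun _ hz => hz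
  refine ⟨w :: l, List.isChain_cons_cons.2 ⟨huw, hchain⟩,
    List.nodup_cons.2 ⟨fun h => hlB w h (Set.mem_insert w B), hnodup⟩, ?_, fun _ => hw, ?_⟩
  · exact List.forall_mem_cons.2 ⟨hwB, fun z hz hzB => hlB z hz (.inr hzB)⟩
  · intro L hL w' hw' hw'u v hv
    obtain rfl := hN hw hw'
    rw [liveArm, if_pos hw'u, List.mem_cons]
    refine (reflTransGen_avoiding_cases hv).imp_right ?_
    rintro ⟨z, hz, hzw, hvz⟩
    exact hlive L hL z ⟨(hL _ hzw).symm, hz⟩ hzw v hvz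

theorem AtMostTwoNeighbors.exists_fork [Finite V] (hH : AtMostTwoNeighbors H) (m : V) :
    ∃ p q : List V, Fork H m p q ∧ ∀ L : Finset (V × V), (∀ e ∈ L, H.Adj e.1 e.2) →
      ∀ v, Reaches L v m → v = m ∨ v ∈ liveArm L m p ∨ v ∈ liveArm L m q := by
  obtain ⟨a, ha⟩ : ∃ a, {w | H.Adj m w ∧ w ≠ a}.Subsingleton := by
    by_cases h : ∃ a, H.Adj m a
    · obtain ⟨a, ha⟩ := h
      refine ⟨a, fun b hb c hc => ?_⟩
      rcases hH ha hb.1 hc.1 with h | h | h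
      exacts [absurd h.symm hb.2, absurd h.symm hc.2, h]
    · exact ⟨m, fun b hb => absurd ⟨b, hb.1⟩ h⟩
  have hne : ∀ w, H.Adj m w → w ∉ ({m} : Set V) := fun w hw => hw.ne'
  obtain ⟨p, hp, hp', hpm, hpa, hplive⟩ := exists_arm (u := m) (N := {w | H.Adj m w ∧ w = a}) hH
    {m} rfl (fun b hb c hc => hb.2.trans hc.2.symm) fun w hw => ⟨hw.1, hne w hw.1⟩
  obtain ⟨q, hq, hq', hqm, hqa, hqlive⟩ := exists_arm (u := m) hH {m} rfl ha
    fun w hw => ⟨hw.1, hne w hw.1⟩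
  refine ⟨p, q, ⟨hp, hq, List.nodup_cons.2 ⟨fun h => hpm m h rfl, hp'⟩,
    List.nodup_cons.2 ⟨fun h => hqm m h rfl, hq'⟩, fun h h' hpq => ?_⟩, fun L hL v hv => ?_⟩
  · exact (hqa h').2 (hpq ▸ (hpa h).2)
  · have hv' : Relation.ReflTransGen (fun a b => (a, b) ∈ L ∧ a ∉ (∅ : Set V)) v m := by
      simpa [Reaches] using hv
    refine (reflTransGen_avoiding_cases hv').imp_right ?_
    rintro ⟨z, -, hzm, hvz⟩
    rw [insert_empty_eq] at hvz
    have hmz : H.Adj m z := (hL _ hzm).symm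
    by_cases hza : z = a
    · exact .inl (hplive L hL z ⟨hmz, hza⟩ hzm v hvz)
    · exact .inr (hqlive L hL z ⟨hmz, hza⟩ hzm v hvz)

theorem Reaches.reachable {L : Finset (V × V)} (hL : ∀ e ∈ L, H.Adj e.1 e.2) {u v : V}
    (h : Reaches L u v) : H.Reachable u v :=
  (SimpleGraph.reachable_iff_reflTransGen u v).2
    (Relation.ReflTransGen.mono (fun a b hab => hL (a, b) hab) u v h)

end Forks

section NodeBound

variable {V : Type*} [Fintype V] {H : SimpleGraph V} {L : Finset (V × V)} {m : V} {p q : List V}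

theorem one_sub_exp_neg_mul_le {t K : ℝ} (ht : 0 ≤ t) (htK : t ≤ K) :
    (1 - Real.exp (-K)) * t ≤ K * (1 - Real.exp (-t)) := by
  rcases (ht.trans htK).eq_or_lt with rfl | hK
  · simp
  have h := convexOn_exp.2 (Set.mem_univ (-K)) (Set.mem_univ 0) (div_nonneg ht hK.le)
    (sub_nonneg.2 ((div_le_one hK).2 htK)) (add_sub_cancel _ _)
  have harg : t / K * -K + (1 - t / K) * 0 = -t := by field_simp; ring
  simp only [smul_eq_mul, harg, Real.exp_zero, mul_one] at h
  have hmul := mul_le_mul_of_nonneg_left h hK.le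
  have hdist : K * (t / K * Real.exp (-K) + (1 - t / K)) = K - (1 - Real.exp (-K)) * t := by
    field_simp
    ring
  linarith

/-- The extreme case is `a = b = 1 / 2`, where `1 - (1 - a / 2) * (1 - b / 2) = 7 / 16`. -/
theorem mul_le_one_sub_seven_div_sixteen_mul {r a b A B : ℝ} (hr : r ≤ 1) (hrab : r ≤ a + b)
    (ha : 0 ≤ a) (ha1 : a ≤ 1) (hb : 0 ≤ b) (hB0 : 0 ≤ B) (hA : a ≤ 2 - 2 * A)
    (hB : b ≤ 2 - 2 * B) : A * B ≤ 1 - 7 / 16 * r := by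
  have hAB : A * B ≤ (1 - a / 2) * (1 - b / 2) :=
    mul_le_mul (by linarith) (by linarith) hB0 (by linarith)
  rcases le_total (a + b) 1 with h | h
  · nlinarith [sq_nonneg (a - b), mul_nonneg (add_nonneg ha hb) (sub_nonneg.2 h)]
  · nlinarith [sq_nonneg (a - b), mul_nonneg (sub_nonneg.2 h) (by linarith : 0 ≤ 7 - (a + b))]

open scoped Classical in
theorem Fork.one_sub_exp_neg_mul_one_sub_missProb_le (hH : AtMostTwoNeighbors H) (F : Fork H m p q)
    {x : V → ℝ} (hx : ∀ v, 0 ≤ x v) {K : ℝ} (hK0 : 0 ≤ K)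
    (hK : K ≤ ∑ v with H.Reachable m v, x v) :
    (1 - Real.exp (-K)) *
        (1 - missProb x (m :: liveArm L m p : List V) * missProb x (liveArm L m q)) ≤
      1 - missProb x (coreach L m).val := by
  have F' := F.of_isPrefix (liveArm_isPrefix L m p) (liveArm_isPrefix L m q)
  have hm : m ∈ coreach L m := mem_coreach.2 .refl
  have hp : ∀ v ∈ liveArm L m p, v ∈ coreach L m := fun v hv =>
    mem_coreach.2 (reaches_of_mem_liveArm hv)
  have hq : ∀ v ∈ liveArm L m q, v ∈ coreach L m := fun v hv =>
    mem_coreach.2 (reaches_of_mem_liveArm hv)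
  have hexp : Real.exp (-K) ≤ 1 := Real.exp_le_one_iff.2 (neg_nonpos.2 hK0)
  rw [← missProb_add, Multiset.coe_add]
  by_cases hd : (liveArm L m p).Disjoint (liveArm L m q)
  · have hnodup : ((m :: liveArm L m p) ++ liveArm L m q).Nodup :=
      F'.nodup_left.append F'.nodup_right.of_cons
        (List.disjoint_cons_left.2 ⟨(List.nodup_cons.1 F'.nodup_right).1, hd⟩)
    have hle : ((m :: liveArm L m p ++ liveArm L m q : List V) : Multiset V) ≤
        (coreach L m).val := by
      refine (Multiset.le_iff_subset (Multiset.coe_nodup.2 hnodup)).2 fun v hv => ?_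
      simp only [Multiset.mem_coe, List.mem_append, List.mem_cons] at hv
      rcases hv with (rfl | hv) | hv
      exacts [hm, hp v hv, hq v hv]
    calc _ ≤ 1 - missProb x (m :: liveArm L m p ++ liveArm L m q : List V) :=
          mul_le_of_le_one_left (sub_nonneg.2 (missProb_le_one hx _))
            (sub_le_self 1 (Real.exp_nonneg _))
      _ ≤ _ := sub_le_sub_left (missProb_antitone hx hle) 1
  · have hsub : (Finset.univ.filter fun v => H.Reachable m v) ⊆ coreach L m := fun v hv => by
      rcases F'.mem_or_mem_of_reachable hH hd (Finset.mem_filter.1 hv).2 with h | h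
      · exact (List.mem_cons.1 h).elim (fun h => h ▸ hm) (hp v)
      · exact (List.mem_cons.1 h).elim (fun h => h ▸ hm) (hq v)
    calc _ ≤ 1 - Real.exp (-K) :=
          mul_le_of_le_one_right (sub_nonneg.2 hexp) (sub_le_self 1 (missProb_nonneg x _))
      _ ≤ _ := by
          rw [missProb_val]
          have := Finset.sum_le_sum_of_subset_of_nonneg hsub fun v _ _ => hx v
          gcongr
          linarith

namespace InfluenceGraph

variable {G : InfluenceGraph V} (π : AdaptivePolicy V)

theorem one_sub_exp_neg_mul_probability_activated_le {K : ℝ}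
    (hK : ∀ L ⊆ G.edges, ∑ v ∈ coreach L m, G.seedProb π v ≤ K) :
    (1 - Real.exp (-K)) * G.probability (fun L => m ∈ (π.run L).activated) ≤
      K * G.expect fun L => 1 - missProb (G.seedProb π) (coreach L m).val := by
  have hnonneg : ∀ L, 0 ≤ ∑ v ∈ coreach L m, G.seedProb π v := fun L =>
    Finset.sum_nonneg fun v _ => G.seedProb_nonneg π v
  have hexp : Real.exp (-K) ≤ 1 := Real.exp_le_one_iff.2
    (neg_nonpos.2 ((hnonneg ∅).trans (hK ∅ (Finset.empty_subset _))))
  calc _ ≤ (1 - Real.exp (-K)) * G.expect (fun L => ∑ v ∈ coreach L m, G.seedProb π v) := by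
        rw [expect_sum_coreach]
        exact mul_le_mul_of_nonneg_left (G.probability_activated_le_sum π m) (sub_nonneg.2 hexp)
    _ ≤ _ := by
        simp only [← expect_const_mul, missProb_val]
        exact G.expect_mono fun L hL => one_sub_exp_neg_mul_le (hnonneg L) (hK L hL)

theorem expect_missProb_mul_of_disjoint (G : InfluenceGraph V)
    (hd : (armEdges m p).Disjoint (armEdges m q)) (x : V → ℝ) :
    G.expect (fun L => missProb x (m :: liveArm L m p : List V) * missProb x (liveArm L m q)) =
      G.expect (fun L => missProb x (m :: liveArm L m p : List V)) *
        G.expect (fun L => missProb x (liveArm L m q)) := by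
  classical
  refine G.expect_mul_of_indep (armEdges m p).toFinset (fun L => ?_) fun L => ?_
  · rw [liveArm_congr (L' := L ∩ (armEdges m p).toFinset) fun e he => by simp [he]]
  · rw [liveArm_congr (L' := L \ (armEdges m p).toFinset) fun e he => by
      simp [List.disjoint_right.1 hd he]]

theorem probability_activated_le_add_picksFrom
    (hpq : ∀ L ⊆ G.edges, ∀ v, Reaches L v m → v = m ∨ v ∈ liveArm L m p ∨ v ∈ liveArm L m q) :
    G.probability (fun L => m ∈ (π.run L).activated) ≤
      G.probability (fun L => π.PicksFrom L m (m :: liveArm L m p)) +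
        G.probability (fun L => π.PicksFrom L m (liveArm L m q)) := by
  refine (G.probability_mono fun L hL hm => ?_).trans (G.probability_or_le _ _)
  obtain ⟨i, hi, v, hpick, hnew, hv⟩ := π.exists_picks_of_mem_activated L hm
  rcases hpq L hL v hv with rfl | h | h
  · exact .inl ⟨i, hi, v, List.mem_cons_self, hpick, hnew⟩
  · exact .inl ⟨i, hi, v, List.mem_cons_of_mem m h, hpick, hnew⟩
  · exact .inr ⟨i, hi, v, h, hpick, hnew⟩

open scoped Classical in
theorem one_sub_exp_neg_mul_probability_activated_le_of_le_sum
    (hGH : ∀ e ∈ G.edges, H.Adj e.1 e.2) (hH : AtMostTwoNeighbors H) {K : ℝ} (hK0 : 0 ≤ K)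
    (hK : K ≤ ∑ v with H.Reachable m v, G.seedProb π v) :
    (1 - Real.exp (-K)) * G.probability (fun L => m ∈ (π.run L).activated) ≤
      16 / 7 * G.expect fun L => 1 - missProb (G.seedProb π) (coreach L m).val := by
  obtain ⟨p, q, F, hpq⟩ := hH.exists_fork m
  have hprod := mul_le_one_sub_seven_div_sixteen_mul (G.probability_le_one _)
    (probability_activated_le_add_picksFrom π fun L hL => hpq L fun e he => hGH e (hL he))
    (G.probability_nonneg _) (G.probability_le_one _) (G.probability_nonneg _)
    (G.expect_nonneg fun L _ => missProb_nonneg _ _)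
    (G.probability_picksFrom_cons_le π m _ (G.probability_picksFrom_liveArm_le π F.nodup_left))
    (G.probability_picksFrom_liveArm_le π F.nodup_right)
  rw [← G.expect_missProb_mul_of_disjoint (F.disjoint_armEdges hH)] at hprod
  have hmean := G.expect_mono fun L _ =>
    F.one_sub_exp_neg_mul_one_sub_missProb_le (L := L) hH (G.seedProb_nonneg π) hK0 hK
  rw [expect_const_mul, expect_sub, expect_const] at hmean
  have hexp : 0 ≤ 1 - Real.exp (-K) := sub_nonneg.2 (Real.exp_le_one_iff.2 (neg_nonpos.2 hK0))
  calc _ ≤ (1 - Real.exp (-K)) * (16 / 7 * (1 - G.expect fun L =>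
          missProb (G.seedProb π) (m :: liveArm L m p : List V) *
            missProb (G.seedProb π) (liveArm L m q))) :=
        mul_le_mul_of_nonneg_left (by linarith) hexp
    _ ≤ _ := by linarith

theorem probability_activated_le_of_atMostTwoNeighbors (hGH : ∀ e ∈ G.edges, H.Adj e.1 e.2)
    (hH : AtMostTwoNeighbors H) (m : V) :
    (1 - Real.exp (-(16 / 7))) * G.probability (fun L => m ∈ (π.run L).activated) ≤
      16 / 7 * G.expect fun L => 1 - missProb (G.seedProb π) (coreach L m).val := by
  classical
  rcases le_total (16 / 7) (∑ v with H.Reachable m v, G.seedProb π v) with hK | hK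
  · exact one_sub_exp_neg_mul_probability_activated_le_of_le_sum π hGH hH (by norm_num) hK
  · refine one_sub_exp_neg_mul_probability_activated_le π fun L hL => le_trans ?_ hK
    refine Finset.sum_le_sum_of_subset_of_nonneg (fun v hv => ?_) fun v _ _ => G.seedProb_nonneg π v
    have hvm := (mem_coreach.1 hv).reachable fun e he => hGH e (hL he)
    simpa using hvm.symm

theorem policySpread_le_of_atMostTwoNeighbors (hGH : ∀ e ∈ G.edges, H.Adj e.1 e.2)
    (hH : AtMostTwoNeighbors H) {k : ℕ} (hk : 0 < k) (hkV : k ≤ Fintype.card V)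
    (hπ : G.PolicySize π k) :
    G.policySpread π ≤ 16 / 7 / (1 - Real.exp (-(16 / 7))) * G.optN k := by
  have hexp : 0 < 1 - Real.exp (-(16 / 7)) :=
    sub_pos.2 (Real.exp_lt_one_iff.2 (by norm_num))
  rw [div_mul_eq_mul_div, le_div_iff₀' hexp, policySpread, expect_card_eq_sum, Finset.mul_sum]
  calc _ ≤ ∑ m, 16 / 7 * G.expect fun L => 1 - missProb (G.seedProb π) (coreach L m).val :=
        Finset.sum_le_sum fun m _ => probability_activated_le_of_atMostTwoNeighbors π hGH hH m
    _ ≤ 16 / 7 * G.optN k := by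
        rw [← Finset.mul_sum]
        exact mul_le_mul_of_nonneg_left (G.sum_expect_one_sub_missProb_le_optN
          (G.seedProb_nonneg π) hk hkV (G.sum_seedProb π hπ)) (by norm_num)

end InfluenceGraph

open scoped Classical in
theorem atMostTwoNeighbors_of_sum_degree_eq_zero (h : ∑ v with 2 < H.degree v, H.degree v = 0) :
    AtMostTwoNeighbors H := by
  intro v a b c ha hb hc
  by_contra! hne
  have hcard : 2 < H.degree v := Finset.two_lt_card.2
    ⟨a, by simpa using ha, b, by simpa using hb, c, by simpa using hc, hne⟩
  have := Finset.sum_eq_zero_iff.1 h v (by simpa using hcard)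
  omega

end NodeBound

section Constants

theorem sixteen_div_seven_div_le_three : 16 / 7 / (1 - Real.exp (-(16 / 7))) ≤ 3 := by
  have hexp : 21 / 5 ≤ Real.exp (16 / 7) :=
    le_trans (by norm_num) (Real.quadratic_le_exp_of_nonneg (x := 16 / 7) (by norm_num))
  have hinv : Real.exp (-(16 / 7)) ≤ 5 / 21 := by
    rw [Real.exp_neg]
    exact (inv_anti₀ (by norm_num) hexp).trans (by norm_num)
  rw [div_le_iff₀ (by linarith)]
  linarith

theorem max_zero_one_sub_div_pow_le_exp_neg {a : ℝ} {k : ℕ} (hk : k ≠ 0) :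
    max 0 (1 - a / k) ^ k ≤ Real.exp (-a) := by
  have hk' : (0 : ℝ) < k := Nat.cast_pos.2 (Nat.pos_of_ne_zero hk)
  rcases le_total a k with h | h
  · rw [max_eq_right (sub_nonneg.2 ((div_le_one hk').2 h))]
    exact Real.one_sub_div_pow_le_exp_neg h
  · rw [max_eq_left (sub_nonpos.2 ((one_le_div hk').2 h)), zero_pow hk]
    exact Real.exp_nonneg _

theorem three_le_three_div {k : ℕ} (hk : k ≠ 0) :
    3 ≤ 3 / (1 - max 0 (1 - 3 / (k : ℝ)) ^ k) := by
  have hle := max_zero_one_sub_div_pow_le_exp_neg (a := 3) hk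
  have hlt : Real.exp (-3) < 1 := Real.exp_lt_one_iff.2 (by norm_num)
  have hnonneg : 0 ≤ max 0 (1 - 3 / (k : ℝ)) ^ k := pow_nonneg (le_max_left _ _) k
  rw [le_div_iff₀ (by linarith)]
  linarith

theorem three_div_le_three_mul_exp_div {k : ℕ} (hk : k ≠ 0) :
    3 / (1 - max 0 (1 - 3 / (k : ℝ)) ^ k) ≤ 3 * Real.exp 3 / (Real.exp 3 - 1) := by
  have hle := max_zero_one_sub_div_pow_le_exp_neg (a := 3) hk
  have hexp : 1 < Real.exp 3 := Real.one_lt_exp_iff.2 (by norm_num)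
  have hlt : Real.exp (-3) < 1 := Real.exp_lt_one_iff.2 (by norm_num)
  calc 3 / (1 - max 0 (1 - 3 / (k : ℝ)) ^ k) ≤ 3 / (1 - Real.exp (-3)) :=
        div_le_div_of_nonneg_left (by norm_num) (sub_pos.2 hlt) (sub_le_sub_left hle 1)
    _ = 3 * Real.exp 3 / (Real.exp 3 - 1) := by
        rw [Real.exp_neg] at hlt ⊢
        rw [div_eq_div_iff (sub_pos.2 hlt).ne' (sub_pos.2 hexp).ne']
        field_simp

theorem abs_three_mul_exp_div_sub_lt :
    |3 * Real.exp 3 / (Real.exp 3 - 1) - 3.16| < 0.005 := by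
  have hpow : Real.exp 3 = Real.exp 1 ^ 3 := by rw [← Real.exp_nat_mul]; norm_num
  have hlower : 20 < Real.exp 3 := by
    rw [hpow]
    calc (20 : ℝ) < 2.718 ^ 3 := by norm_num
      _ ≤ Real.exp 1 ^ 3 := by gcongr; linarith [Real.exp_one_gt_d9]
  have hupper : Real.exp 3 < 20.2 := by
    rw [hpow]
    calc Real.exp 1 ^ 3 ≤ 2.72 ^ 3 := by gcongr; linarith [Real.exp_one_lt_d9]
      _ < 20.2 := by norm_num
  have hpos : 0 < Real.exp 3 - 1 := by linarith
  rw [abs_lt, lt_sub_iff_add_lt, sub_lt_iff_lt_add, lt_div_iff₀ hpos, div_lt_iff₀ hpos]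
  constructor <;> linarith

end Constants

theorem theorem5p2_general (k : ℕ) (hk : k ≠ 0) :
    adaptivityGap.{u} (fun V _ => boundedClass 0 V) k ≤
      ((min (k : ℝ) (16 / 7 / (1 - Real.exp (-(16 / 7)))) : ℝ) : EReal) := by
  have hk' := Nat.pos_of_ne_zero hk
  have hexp : Real.exp (-(16 / 7)) ≤ 1 := Real.exp_le_one_iff.2 (by norm_num)
  rw [EReal.coe_strictMono.monotone.map_min, le_min_iff]
  constructor
  · exact adaptivityGap_le k.cast_nonneg fun V _ G _ hkV π hπ =>
      G.policySpread_le_mul_optN hπ hk' hkV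
  · refine adaptivityGap_le (div_nonneg (by norm_num) (sub_nonneg.2 hexp)) ?_
    rintro V _ G ⟨H, hGH, hdeg⟩ hkV π hπ
    exact G.policySpread_le_of_atMostTwoNeighbors π
      (fun e he => (hGH _ _).1 (G.mem_edges.1 he))
      (atMostTwoNeighbors_of_sum_degree_eq_zero (Nat.le_zero.1 hdeg)) hk' hkV hπ

theorem theorem5p2 (k : ℕ) (hk : 2 ≤ k) :
    adaptivityGap.{u} (fun V _ => boundedClass 0 V) k ≤
        ((min (k : ℝ) (3 / (1 - (max 0 (1 - 3 / (k : ℝ))) ^ k)) : ℝ) : EReal) ∧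
      min (k : ℝ) (3 / (1 - (max 0 (1 - 3 / (k : ℝ))) ^ k)) ≤
        3 * Real.exp 3 / (Real.exp 3 - 1) ∧
      |3 * Real.exp 3 / (Real.exp 3 - 1) - 3.16| < 0.005 := by
  have hk0 : k ≠ 0 := by omega
  refine ⟨(theorem5p2_general k hk0).trans (EReal.coe_le_coe_iff.2 (min_le_min_left _ ?_)),
    (min_le_right _ _).trans (three_div_le_three_mul_exp_div hk0), abs_three_mul_exp_div_sub_lt⟩
  exact sixteen_div_seven_div_le_three.trans (three_le_three_div hk0)
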